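/- There is a universal constant $C>0$ such that the following holds. Let $n$ be a natural number, let $\delta\in(0,1]$, and let $A=(a_{ij})$ be an $n\times n$ real random matrix whose entries are independent and identically distributed with $\mathbb{E}a_{ij}=0$ and $\mathbb{E}a_{ij}^2=1$. Let $\mathcal{D}^2_n$ denote the set of all $n\times n$ diagonal matrices whose diagonal entries all belong to $\{1\}\cup\{2^{-2^k}: k=0,1,2,\dots\}$, and for an $n\times n$ real matrix $M$ let $\|M\|_{\infty\to 2}$ be the operator norm of $M$ as a map from $(\mathbb{R}^n,\|\cdot\|_\infty)$ to $(\mathbb{R}^n,\|\cdot\|_2)$. Then $$\mathbb{P}\Bigl\{\exists D\in\mathcal{D}^2_n:\ \det D\ge \exp(-\delta n)\ \text{ and }\ \|AD\|_{\infty\to 2}\le \frac{C}{\sqrt{\delta}}\,n\Bigr\}\ \ge\ 1-4\exp(-\delta n/8).$$ -/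

import Mathlib

open MeasureTheory ProbabilityTheory

/-- The entries of the `n × n` real random matrix `A` are i.i.d. random variables with mean zero and
unit second moment. -/
structure HasIIDStandardEntries {Ω : Type*} [MeasurableSpace Ω] {n : ℕ}
    (A : Ω → Matrix (Fin n) (Fin n) ℝ) (μ : Measure Ω) : Prop where
  measurable_entry : ∀ i j, Measurable (fun ω => A ω i j)
  indep : iIndepFun (fun (p : Fin n × Fin n) (ω : Ω) => A ω p.1 p.2) μ
  identDistrib : ∀ i j k l, IdentDistrib (fun ω => A ω i j) (fun ω => A ω k l) μ μ
  mean_zero : ∀ i j, ∫ ω, A ω i j ∂μ = 0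
  second_moment_one : ∀ i j, ∫ ω, (A ω i j) ^ 2 ∂μ = 1

/-- Positive diagonal contractions: diagonal matrices with diagonal entries in `(0, 1]`. -/
def posDiagContractions (n : ℕ) : Set (Matrix (Fin n) (Fin n) ℝ) :=
  {D | D.IsDiag ∧ ∀ i, D i i ∈ Set.Ioc (0 : ℝ) 1}

/-- Positive diagonal contractions with diagonal entries in `{1} ∪ {2 ^ (-2 ^ k) : k = 0, 1, …}`. -/
def dyadicDiagContractions (n : ℕ) : Set (Matrix (Fin n) (Fin n) ℝ) :=
  {D | D ∈ posDiagContractions n ∧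
    ∀ i, D i i ∈ ({1} ∪ Set.range fun k : ℕ => ((2 : ℝ) ^ (2 ^ k))⁻¹ : Set ℝ)}

/-- The operator norm of `M`, viewed as a map from `ℝⁿ` with the sup norm
to `ℝᵐ` with the Euclidean norm. -/
noncomputable def normInftyTwo {m n : ℕ} (M : Matrix (Fin m) (Fin n) ℝ) : ℝ :=
  ‖(LinearMap.toContinuousLinearMap
    ((WithLp.linearEquiv 2 ℝ (Fin m → ℝ)).symm.toLinearMap ∘ₗ M.mulVecLin) :
      (Fin n → ℝ) →L[ℝ] EuclideanSpace ℝ (Fin m))‖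

/-!
The proof rests on two properties of `A`, each of which fails only with exponentially small
probability.

*Damping.* For a vector `x ≥ 0`, truncate at the largest dyadic level `λ` at which
`∑ min (x j, λ)` is at most one. Truncation can be carried out, up to a factor two, by weights
in `{1} ∪ {2 ^ (-2 ^ k)}` (`exists_dyadicWeight_truncation`), and the inverse product of the
weights is bounded by `dampingCost x` (`exists_damping`), because at level `2 λ` the truncated mass
is still more than one, which for independent coordinates of small mean is exponentially rare. When
`x` has independent entries of mean `ε` with `n ε` small, the expected cost is at most
`exp (64 n ε)` (`lintegral_dampingCost_le`). Applied to the rescaled squares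
`x j = δ / (128 n) * a i j ^ 2` of each of the `n` independent rows, this and Markov's inequality
show that, outside an event of probability `exp (-δ n / 2)`, the product of all `n ^ 2` weights is
at least `exp (-δ n)`. The columnwise smallest weights then form a matrix `D` with
`det D ≥ exp (-δ n)` such that every row of `A D` has squared Euclidean norm at most `256 n / δ`.

*Self-normalisation.* Fix such a `D` and a sign vector `s`. From `exp (x - x²) ≤ 1 + x + x²` the
sum `S = ∑ aᵢⱼ dⱼ sⱼ` with quadratic variation `Q = ∑ (aᵢⱼ dⱼ)²` satisfies
`𝔼 exp (r S - r² Q) ≤ exp (r² n)`, without any assumption beyond two moments. Integrating over `r`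
against a Gaussian weight gives `𝔼 [exp (S² / (8 (b + n))); Q ≤ b] ≤ √2`
(`lintegral_indicator_exp_sq_le`). Multiplying over the rows with `b = 256 n / δ` bounds the
probability that all rows of `A D` are damped but `|A D s|² ≥ 10⁴ n² / δ` by
`√2ⁿ exp (-4 n)`. There are `2ⁿ` sign vectors and at most `(2e)ⁿ` matrices `D`
(`card_dyadicWeight_prod_ge`), so a union bound leaves probability `exp (-n)`. This union bound is
what makes it harmless that the matrix `D` depends on `A`. Finally, the norm from `ℓ∞` to `ℓ2` is
attained at a sign vector (`normInftyTwo_le_of_signVectors`).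
-/

/-! ### Dyadic weights -/

/-- An enumeration of the admissible diagonal entries `1, 2 ^ (-2 ^ 0), 2 ^ (-2 ^ 1), …`. -/
noncomputable def dyadicWeight : ℕ → ℝ
  | 0 => 1
  | k + 1 => ((2 : ℝ) ^ (2 ^ k))⁻¹

lemma dyadicWeight_pos (k : ℕ) : 0 < dyadicWeight k := by
  cases k <;> simp [dyadicWeight]

lemma dyadicWeight_antitone : Antitone dyadicWeight := by
  refine antitone_nat_of_succ_le fun k => ?_
  cases k with
  | zero => norm_num [dyadicWeight]
  | succ k =>
    simp only [dyadicWeight]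
    gcongr
    · norm_num
    · norm_num
    · omega

lemma dyadicWeight_le_one (k : ℕ) : dyadicWeight k ≤ 1 :=
  dyadicWeight_antitone (Nat.zero_le k)

lemma dyadicWeight_mem (k : ℕ) :
    dyadicWeight k ∈ ({1} ∪ Set.range fun k : ℕ => ((2 : ℝ) ^ (2 ^ k))⁻¹ : Set ℝ) := by
  cases k with
  | zero => exact Or.inl rfl
  | succ k => exact Or.inr ⟨k, rfl⟩

lemma dyadicWeight_succ_le (k : ℕ) : dyadicWeight (k + 1) ≤ (1 / 2) ^ (k + 1) := by
  rw [dyadicWeight, ← inv_pow, one_div]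
  exact pow_le_pow_of_le_one (by norm_num) (by norm_num) Nat.lt_two_pow_self

lemma sum_dyadicWeight_le_two (N : ℕ) : ∑ k ∈ Finset.range N, dyadicWeight k ≤ 2 := by
  calc ∑ k ∈ Finset.range N, dyadicWeight k ≤ ∑ k ∈ Finset.range N, (1 / 2 : ℝ) ^ k := by
        refine Finset.sum_le_sum fun k _ => ?_
        cases k with
        | zero => simp [dyadicWeight]
        | succ k => exact dyadicWeight_succ_le k
    _ ≤ ∑' k : ℕ, (1 / 2 : ℝ) ^ k :=
        summable_geometric_two.sum_le_tsum _ fun k _ => by positivity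
    _ = 2 := tsum_geometric_two

/-- Truncation at level one by an admissible weight: because consecutive values `2 ^ 2 ^ k` are
squares of each other, some weight `w` satisfies both `w⁻¹ ≤ t` and `w² t ≤ 1` when `t ≥ 2`. -/
lemma exists_dyadicWeight_truncation {t : ℝ} (ht : 0 ≤ t) :
    ∃ k, (dyadicWeight k)⁻¹ ≤ max 1 t ∧ dyadicWeight k ^ 2 * t ≤ 2 * min t 1 := by
  rcases lt_or_ge t 2 with h | h
  · refine ⟨0, by simp [dyadicWeight], ?_⟩
    rcases le_total t 1 with h1 | h1 <;> simp [dyadicWeight, h1] <;> linarith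
  · have hex : ∃ k : ℕ, t < (2 : ℝ) ^ (2 ^ k) := by
      obtain ⟨m, hm⟩ := pow_unbounded_of_one_lt t (by norm_num : (1 : ℝ) < 2)
      exact ⟨m, hm.trans_le (pow_le_pow_right₀ (by norm_num) Nat.lt_two_pow_self.le)⟩
    classical
    obtain ⟨m, hm⟩ : ∃ m, Nat.find hex = m + 1 := by
      refine Nat.exists_eq_succ_of_ne_zero fun h0 => ?_
      have := Nat.find_spec hex
      rw [h0] at this
      norm_num at this
      linarith
    have h1 := Nat.find_spec hex
    have h2 := Nat.find_min hex (m := m) (by omega)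
    rw [hm, pow_succ, pow_mul] at h1
    push Not at h2
    refine ⟨m + 1, ?_, ?_⟩
    · simp only [dyadicWeight, inv_inv]
      exact h2.trans (le_max_right _ _)
    · rw [min_eq_right (by linarith), dyadicWeight, inv_pow, inv_mul_le_iff₀ (by positivity)]
      nlinarith

/-- Only exponentially many products of `n` weights are at least `exp (-n)`: weighting each one by
its product and using that the weights sum to at most two. -/
lemma card_dyadicWeight_prod_ge (n : ℕ) :
    ∃ 𝒦 : Finset (Fin n → ℕ),
      (∀ κ : Fin n → ℕ, Real.exp (-n) ≤ ∏ j, dyadicWeight (κ j) → κ ∈ 𝒦) ∧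
      (𝒦.card : ℝ) ≤ 2 ^ n * Real.exp n := by
  classical
  obtain ⟨N, hN⟩ : ∃ N : ℕ, (1 / 2 : ℝ) ^ N < Real.exp (-n) :=
    exists_pow_lt_of_lt_one (Real.exp_pos _) (by norm_num)
  refine ⟨(Fintype.piFinset fun _ => Finset.range N).filter
    fun κ => Real.exp (-n) ≤ ∏ j, dyadicWeight (κ j), fun κ hκ => ?_, ?_⟩
  · rw [Finset.mem_filter, Fintype.mem_piFinset]
    refine ⟨fun j => Finset.mem_range.2 ?_, hκ⟩
    by_contra! hj
    have h1 : ∏ i, dyadicWeight (κ i) ≤ dyadicWeight (κ j) := by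
      rw [← Finset.mul_prod_erase _ _ (Finset.mem_univ j)]
      exact mul_le_of_le_one_right (dyadicWeight_pos _).le
        (Finset.prod_le_one (fun i _ => (dyadicWeight_pos _).le)
          fun i _ => dyadicWeight_le_one _)
    have h2 : dyadicWeight (κ j) ≤ (1 / 2) ^ N := by
      refine (dyadicWeight_antitone hj).trans ?_
      cases N with
      | zero => simp [dyadicWeight]
      | succ k => exact dyadicWeight_succ_le k
    linarith
  · set 𝒦 := (Fintype.piFinset fun _ : Fin n => Finset.range N).filter
      fun κ => Real.exp (-n) ≤ ∏ j, dyadicWeight (κ j)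
    have h1 : (𝒦.card : ℝ) * Real.exp (-n) ≤ 2 ^ n := by
      calc (𝒦.card : ℝ) * Real.exp (-n) = ∑ κ ∈ 𝒦, Real.exp (-n) := by simp
        _ ≤ ∑ κ ∈ 𝒦, ∏ j, dyadicWeight (κ j) :=
            Finset.sum_le_sum fun κ hκ => (Finset.mem_filter.1 hκ).2
        _ ≤ ∑ κ ∈ Fintype.piFinset fun _ : Fin n => Finset.range N, ∏ j, dyadicWeight (κ j) :=
            Finset.sum_le_sum_of_subset_of_nonneg (Finset.filter_subset _ _)
              fun κ _ _ => Finset.prod_nonneg fun j _ => (dyadicWeight_pos _).le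
        _ = ∏ _j : Fin n, ∑ k ∈ Finset.range N, dyadicWeight k :=
            (Finset.prod_univ_sum _ _).symm
        _ = (∑ k ∈ Finset.range N, dyadicWeight k) ^ n := by simp
        _ ≤ 2 ^ n := pow_le_pow_left₀
            (Finset.sum_nonneg fun k _ => (dyadicWeight_pos _).le) (sum_dyadicWeight_le_two N) n
    rwa [Real.exp_neg, ← div_eq_mul_inv, div_le_iff₀ (Real.exp_pos _)] at h1

/-! ### Damping a nonnegative vector -/

/-- The factor by which one coordinate, measured in units of the truncation level, enters the
damping cost: the price `max 1 t` of truncating it, times an exponential weight on its truncated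
size. -/
noncomputable def dampingFactor (t : ℝ) : ℝ := max 1 t * Real.exp (min t 2)

/-- The contribution to the damping cost of the truncation level `2 ^ (-l)`. -/
noncomputable def dampingTerm {n : ℕ} (l : ℕ) (x : Fin n → ℝ) : ENNReal :=
  ENNReal.ofReal (Real.exp (-2 ^ l)) *
    ∑ j, ENNReal.ofReal (min (2 ^ l * x j) 2 / 2 ^ l) *
      ∏ i, ENNReal.ofReal (dampingFactor (2 ^ l * x i))

/-- A majorant, with computable expectation, of the inverse product of weights needed to damp the
nonnegative vector `x` to total mass at most two. It sums over all truncation levels instead of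
selecting the one that is used. -/
noncomputable def dampingCost {n : ℕ} (x : Fin n → ℝ) : ENNReal :=
  1 + ∑' l, dampingTerm l x

lemma dampingFactor_nonneg (t : ℝ) : 0 ≤ dampingFactor t := by
  unfold dampingFactor; positivity

lemma measurable_dampingFactor : Measurable dampingFactor := by
  unfold dampingFactor; fun_prop

lemma measurable_dampingCost {n : ℕ} : Measurable (dampingCost (n := n)) := by
  have := measurable_dampingFactor
  unfold dampingCost dampingTerm
  fun_prop

/-- At a level `2 ^ (-l)` where the truncated mass `∑ min (2 ^ l * x j) 2` exceeds `2 ^ l`, the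
price of truncating is at most the corresponding term of the damping cost. -/
lemma prod_max_one_le_dampingTerm {n l : ℕ} {x : Fin n → ℝ} (hx : ∀ j, 0 ≤ x j)
    (hl : (2 : ℝ) ^ l ≤ ∑ j, min (2 ^ l * x j) 2) :
    ENNReal.ofReal (∏ j, max 1 (2 ^ l * x j)) ≤ dampingTerm l x := by
  have hpow : (0 : ℝ) < 2 ^ l := by positivity
  have ht : ∀ j, 0 ≤ min (2 ^ l * x j) 2 := fun j =>
    le_min (mul_nonneg hpow.le (hx j)) (by norm_num)
  rw [dampingTerm, ← Finset.sum_mul, ← ENNReal.ofReal_prod_of_nonneg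
    (fun i _ => dampingFactor_nonneg _), ← ENNReal.ofReal_sum_of_nonneg
    (fun j _ => div_nonneg (ht j) hpow.le), ← ENNReal.ofReal_mul
    (Finset.sum_nonneg fun j _ => div_nonneg (ht j) hpow.le), ← ENNReal.ofReal_mul
    (Real.exp_pos _).le]
  refine ENNReal.ofReal_le_ofReal ?_
  simp only [dampingFactor, Finset.prod_mul_distrib, ← Real.exp_sum, ← Finset.sum_div]
  set s := ∑ j, min (2 ^ l * x j) 2
  have hP : 0 ≤ ∏ j, max 1 (2 ^ l * x j) := Finset.prod_nonneg fun j _ => by positivity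
  have h1 : 1 ≤ s / 2 ^ l := (one_le_div hpow).2 hl
  have h2 : 1 ≤ Real.exp (-2 ^ l) * Real.exp s := by
    rw [← Real.exp_add]; exact Real.one_le_exp (by linarith)
  calc ∏ j, max 1 (2 ^ l * x j)
      ≤ (s / 2 ^ l) * (Real.exp (-2 ^ l) * Real.exp s) * ∏ j, max 1 (2 ^ l * x j) :=
        le_mul_of_one_le_left hP (one_le_mul_of_one_le_of_one_le h1 h2)
    _ = _ := by ring

/-- If the mass of `x` exceeds one, the weights truncate `x` at the largest level `2 ^ (-l)` at
which the truncated mass is at most one. At twice that level the truncated mass exceeds one, so the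
`l`-th term of the damping cost pays for the truncation. -/
lemma exists_damping {n : ℕ} {x : Fin n → ℝ} (hx : ∀ j, 0 ≤ x j) :
    ∃ κ : Fin n → ℕ, ∑ j, dyadicWeight (κ j) ^ 2 * x j ≤ 2 ∧
      ENNReal.ofReal (∏ j, (dyadicWeight (κ j))⁻¹) ≤ dampingCost x := by
  classical
  have hex : ∃ l : ℕ, ∑ j, min (2 ^ l * x j) 2 ≤ (2 : ℝ) ^ l := by
    obtain ⟨l, hl⟩ := pow_unbounded_of_one_lt (∑ _j : Fin n, (2 : ℝ)) (by norm_num : (1 : ℝ) < 2)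
    exact ⟨l, (Finset.sum_le_sum fun j _ => min_le_right _ _).trans hl.le⟩
  have hspec := Nat.find_spec hex
  rcases h0 : Nat.find hex with _ | l
  · refine ⟨fun _ => 0, ?_, by simp [dyadicWeight, dampingCost]⟩
    rw [h0] at hspec
    have hnn : ∀ j, 0 ≤ min (2 ^ 0 * x j) 2 := fun j => le_min (by simpa using hx j) (by norm_num)
    have hj : ∀ j, x j ≤ min (2 ^ 0 * x j) 2 := fun j => by
      have h1 := (Finset.single_le_sum (fun i _ => hnn i) (Finset.mem_univ j)).trans hspec
      have h2 : x j ≤ 2 := by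
        by_contra! h
        rw [min_eq_right (by simpa using h.le)] at h1
        norm_num at h1
      simpa using h2
    have := (Finset.sum_le_sum fun j _ => hj j).trans hspec
    simp only [dyadicWeight]
    norm_num at this ⊢
    linarith
  · have hprev := Nat.find_min hex (m := l) (by omega)
    rw [h0] at hspec
    push Not at hprev
    have hpow : (0 : ℝ) < 2 ^ l := by positivity
    choose κ hκ₁ hκ₂ using fun j => exists_dyadicWeight_truncation (mul_nonneg hpow.le (hx j))
    refine ⟨κ, ?_, ?_⟩
    · have h1 : ∑ j, min (2 ^ (l + 1) * x j) 2 = 2 * ∑ j, min (2 ^ l * x j) 1 := by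
        rw [Finset.mul_sum]
        refine Finset.sum_congr rfl fun j _ => ?_
        rw [mul_min_of_nonneg _ _ (by norm_num : (0 : ℝ) ≤ 2), mul_one, pow_succ]
        congr 1
        ring
      have h2 : 2 ^ l * ∑ j, dyadicWeight (κ j) ^ 2 * x j ≤ 2 * ∑ j, min (2 ^ l * x j) 1 := by
        rw [Finset.mul_sum, Finset.mul_sum]
        refine Finset.sum_le_sum fun j _ => le_trans (le_of_eq ?_) (hκ₂ j)
        ring
      rw [h1, pow_succ] at hspec
      have h3 : 2 ^ l * ∑ j, dyadicWeight (κ j) ^ 2 * x j ≤ 2 ^ l * 2 := h2.trans hspec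
      exact le_of_mul_le_mul_left h3 hpow
    · calc ENNReal.ofReal (∏ j, (dyadicWeight (κ j))⁻¹)
          ≤ ENNReal.ofReal (∏ j, max 1 (2 ^ l * x j)) :=
            ENNReal.ofReal_le_ofReal (Finset.prod_le_prod
              (fun j _ => (inv_pos.2 (dyadicWeight_pos _)).le) fun j _ => hκ₁ j)
        _ ≤ dampingTerm l x := prod_max_one_le_dampingTerm hx hprev.le
        _ ≤ ∑' l, dampingTerm l x := ENNReal.le_tsum l
        _ ≤ dampingCost x := le_add_self

lemma exp_two_le_eight : Real.exp 2 ≤ 8 := by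
  have h := Real.exp_one_lt_d9
  have h2 : Real.exp 2 = Real.exp 1 * Real.exp 1 := by rw [← Real.exp_add]; norm_num
  nlinarith [Real.exp_pos 1]

lemma dampingFactor_le {t : ℝ} (ht : 0 ≤ t) : dampingFactor t ≤ 1 + 8 * t := by
  unfold dampingFactor
  rcases le_total t 1 with h | h
  · rw [max_eq_left h, min_eq_left (by linarith), one_mul]
    -- convexity of `exp` on `[0, 1]`
    have h1 := convexOn_exp.2 (Set.mem_univ 0) (Set.mem_univ 1) (sub_nonneg.2 h) ht
      (by ring)
    have h2 := Real.exp_one_lt_d9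
    simp at h1
    nlinarith
  · rw [max_eq_right h]
    have : Real.exp (min t 2) ≤ 8 :=
      (Real.exp_le_exp.2 (min_le_right _ _)).trans exp_two_le_eight
    nlinarith

lemma min_mul_dampingFactor_le {t : ℝ} (ht : 0 ≤ t) : min t 2 * dampingFactor t ≤ 16 * t := by
  unfold dampingFactor
  have h1 : Real.exp (min t 2) ≤ 8 :=
    (Real.exp_le_exp.2 (min_le_right _ _)).trans exp_two_le_eight
  have h2 : min t 2 * max 1 t ≤ 2 * t := by
    rcases le_total t 1 with h | h
    · rw [max_eq_left h, min_eq_left (by linarith)]; linarith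
    · rw [max_eq_right h]; nlinarith [min_le_right t 2]
  have h3 : 0 ≤ min t 2 * max 1 t := mul_nonneg (le_min ht (by norm_num)) (by positivity)
  calc min t 2 * (max 1 t * Real.exp (min t 2)) = (min t 2 * max 1 t) * Real.exp (min t 2) := by
        ring
    _ ≤ (2 * t) * 8 := mul_le_mul h2 h1 (Real.exp_pos _).le (by linarith)
    _ = 16 * t := by ring

section DampingExpectation

variable {Ω : Type*} [MeasurableSpace Ω] {μ : Measure Ω} {n : ℕ}
  {X : Fin n → Ω → ℝ} {ε : ℝ}

lemma lintegral_dampingFactor_le [IsProbabilityMeasure μ] {Y : Ω → ℝ} (hY : Measurable Y)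
    (hY0 : ∀ ω, 0 ≤ Y ω) (hε : 0 ≤ ε) (hYε : ∫⁻ ω, ENNReal.ofReal (Y ω) ∂μ ≤ ENNReal.ofReal ε)
    (l : ℕ) :
    ∫⁻ ω, ENNReal.ofReal (dampingFactor (2 ^ l * Y ω)) ∂μ
      ≤ ENNReal.ofReal (Real.exp (8 * 2 ^ l * ε)) := by
  have hc : (0 : ℝ) ≤ 8 * 2 ^ l := by positivity
  calc ∫⁻ ω, ENNReal.ofReal (dampingFactor (2 ^ l * Y ω)) ∂μ
      ≤ ∫⁻ ω, (1 + ENNReal.ofReal (8 * 2 ^ l) * ENNReal.ofReal (Y ω)) ∂μ := by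
        refine lintegral_mono fun ω => ?_
        rw [← ENNReal.ofReal_mul hc, ← ENNReal.ofReal_one,
          ← ENNReal.ofReal_add zero_le_one (mul_nonneg hc (hY0 ω))]
        refine ENNReal.ofReal_le_ofReal
          ((dampingFactor_le (mul_nonneg (by positivity) (hY0 ω))).trans (le_of_eq ?_))
        ring
    _ = 1 + ENNReal.ofReal (8 * 2 ^ l) * ∫⁻ ω, ENNReal.ofReal (Y ω) ∂μ := by
        rw [lintegral_add_left measurable_const, lintegral_const_mul _ (by fun_prop)]
        simp
    _ ≤ 1 + ENNReal.ofReal (8 * 2 ^ l) * ENNReal.ofReal ε := by gcongr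
    _ = ENNReal.ofReal (1 + 8 * 2 ^ l * ε) := by
        rw [← ENNReal.ofReal_mul hc, ← ENNReal.ofReal_one,
          ← ENNReal.ofReal_add zero_le_one (mul_nonneg hc hε)]
    _ ≤ _ := ENNReal.ofReal_le_ofReal (by linarith [Real.add_one_le_exp (8 * 2 ^ l * ε)])

lemma lintegral_min_mul_dampingFactor_le {Y : Ω → ℝ} (hY : Measurable Y) (hY0 : ∀ ω, 0 ≤ Y ω)
    (hYε : ∫⁻ ω, ENNReal.ofReal (Y ω) ∂μ ≤ ENNReal.ofReal ε) (l : ℕ) :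
    ∫⁻ ω, ENNReal.ofReal (min (2 ^ l * Y ω) 2 / 2 ^ l) *
        ENNReal.ofReal (dampingFactor (2 ^ l * Y ω)) ∂μ
      ≤ ENNReal.ofReal (16 * ε) := by
  have hpow : (0 : ℝ) < 2 ^ l := by positivity
  calc _ ≤ ∫⁻ ω, ENNReal.ofReal 16 * ENNReal.ofReal (Y ω) ∂μ := by
        refine lintegral_mono fun ω => ?_
        rw [← ENNReal.ofReal_mul' (dampingFactor_nonneg _), ← ENNReal.ofReal_mul (by norm_num)]
        refine ENNReal.ofReal_le_ofReal ?_
        rw [div_mul_eq_mul_div, div_le_iff₀ hpow]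
        refine (min_mul_dampingFactor_le (mul_nonneg hpow.le (hY0 ω))).trans (le_of_eq ?_)
        ring
    _ = ENNReal.ofReal 16 * ∫⁻ ω, ENNReal.ofReal (Y ω) ∂μ := lintegral_const_mul _ (by fun_prop)
    _ ≤ ENNReal.ofReal 16 * ENNReal.ofReal ε := by gcongr
    _ = _ := (ENNReal.ofReal_mul (by norm_num)).symm

/-- The exponential factor `exp (-2 ^ l)` absorbs the growth `exp (8 * 2 ^ l * n * ε)` of the
product of the damping factors, leaving a term summable in `l`. -/
lemma lintegral_dampingTerm_le [IsProbabilityMeasure μ] (hX : ∀ j, Measurable (X j))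
    (hX0 : ∀ j ω, 0 ≤ X j ω) (hind : iIndepFun X μ) (hε : 0 ≤ ε) (hnε : 16 * (n * ε) ≤ 1)
    (hXε : ∀ j, ∫⁻ ω, ENNReal.ofReal (X j ω) ∂μ ≤ ENNReal.ofReal ε) (l : ℕ) :
    ∫⁻ ω, dampingTerm l (fun j => X j ω) ∂μ
      ≤ ENNReal.ofReal (32 * (n * ε)) * ENNReal.ofReal ((1 / 2) ^ l) := by
  have hmF := measurable_dampingFactor
  set E := ENNReal.ofReal (Real.exp (8 * 2 ^ l * ε)) with hE
  have hE1 : 1 ≤ E := by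
    rw [hE, ← ENNReal.ofReal_one]
    exact ENNReal.ofReal_le_ofReal (Real.one_le_exp (by positivity))
  have hterm : ∀ j, ∫⁻ ω, ENNReal.ofReal (min (2 ^ l * X j ω) 2 / 2 ^ l) *
      ∏ i, ENNReal.ofReal (dampingFactor (2 ^ l * X i ω)) ∂μ ≤ ENNReal.ofReal (16 * ε) * E ^ n := by
    intro j
    let g : Fin n → ℝ → ENNReal := fun i x =>
      (if i = j then ENNReal.ofReal (min (2 ^ l * x) 2 / 2 ^ l) else 1) *
        ENNReal.ofReal (dampingFactor (2 ^ l * x))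
    have hg : ∀ i, Measurable (g i) := fun i => by
      by_cases h : i = j <;> simp only [g, h, if_true, if_false] <;> fun_prop
    calc _ = ∫⁻ ω, ∏ i, g i (X i ω) ∂μ := by
          refine lintegral_congr fun ω => ?_
          simp only [g, Finset.prod_mul_distrib, Finset.prod_ite_eq', Finset.mem_univ, if_true]
      _ = ∏ i, ∫⁻ ω, g i (X i ω) ∂μ :=
          lintegral_prod_eq_prod_lintegral_of_indepFun Finset.univ (fun i ω => g i (X i ω))
            (hind.comp g hg) fun i => (hg i).comp (hX i)
      _ ≤ ∏ i, (if i = j then ENNReal.ofReal (16 * ε) else 1) * E := by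
          refine Finset.prod_le_prod' fun i _ => ?_
          by_cases h : i = j
          · simp only [g, h, if_true]
            exact (lintegral_min_mul_dampingFactor_le (hX j) (hX0 j) (hXε j) l).trans
              (le_mul_of_one_le_right' hE1)
          · simp only [g, h, if_false, one_mul]
            exact lintegral_dampingFactor_le (hX i) (hX0 i) hε (hXε i) l
      _ = ENNReal.ofReal (16 * ε) * E ^ n := by
          rw [Finset.prod_mul_distrib, Finset.prod_ite_eq' Finset.univ j]
          simp
  have hpow : (0 : ℝ) < 2 ^ l := by positivity
  calc ∫⁻ ω, dampingTerm l (fun j => X j ω) ∂μ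
      = ENNReal.ofReal (Real.exp (-2 ^ l)) * ∑ j, ∫⁻ ω, ENNReal.ofReal
          (min (2 ^ l * X j ω) 2 / 2 ^ l) *
            ∏ i, ENNReal.ofReal (dampingFactor (2 ^ l * X i ω)) ∂μ := by
        simp only [dampingTerm]
        rw [lintegral_const_mul _ (by fun_prop), lintegral_finsetSum _ (fun j _ => by fun_prop)]
    _ ≤ ENNReal.ofReal (Real.exp (-2 ^ l)) * ∑ _j : Fin n, ENNReal.ofReal (16 * ε) * E ^ n := by
        gcongr with j
        exact hterm j
    _ = ENNReal.ofReal (Real.exp (-2 ^ l) *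
          (n * (16 * ε * Real.exp (8 * 2 ^ l * ε) ^ n))) := by
        rw [ENNReal.ofReal_mul (Real.exp_pos _).le, ENNReal.ofReal_mul (Nat.cast_nonneg _),
          ENNReal.ofReal_mul (by positivity : 0 ≤ 16 * ε), ENNReal.ofReal_pow (Real.exp_pos _).le,
          Finset.sum_const, Finset.card_univ, Fintype.card_fin, nsmul_eq_mul,
          ENNReal.ofReal_natCast]
    _ ≤ ENNReal.ofReal (32 * (n * ε) * (1 / 2) ^ l) := by
        refine ENNReal.ofReal_le_ofReal ?_
        have h1 : Real.exp (-2 ^ l) * Real.exp (8 * 2 ^ l * ε) ^ n ≤ 2 * (1 / 2) ^ l := by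
          rw [← Real.exp_nat_mul, ← Real.exp_add]
          have h2 : -2 ^ l + n * (8 * 2 ^ l * ε) ≤ -((2 : ℝ) ^ l / 2) := by nlinarith
          refine (Real.exp_le_exp.2 h2).trans ?_
          rw [Real.exp_neg, one_div, inv_pow, inv_le_comm₀ (Real.exp_pos _) (by positivity),
            mul_inv, inv_inv]
          linarith [Real.add_one_le_exp ((2 : ℝ) ^ l / 2)]
        have h3 : 0 ≤ n * (16 * ε) := by positivity
        calc _ = n * (16 * ε) * (Real.exp (-2 ^ l) * Real.exp (8 * 2 ^ l * ε) ^ n) := by ring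
          _ ≤ n * (16 * ε) * (2 * (1 / 2) ^ l) := mul_le_mul_of_nonneg_left h1 h3
          _ = _ := by ring
    _ = _ := ENNReal.ofReal_mul (by positivity)

lemma lintegral_dampingCost_le [IsProbabilityMeasure μ] (hX : ∀ j, Measurable (X j))
    (hX0 : ∀ j ω, 0 ≤ X j ω) (hind : iIndepFun X μ) (hε : 0 ≤ ε) (hnε : 16 * (n * ε) ≤ 1)
    (hXε : ∀ j, ∫⁻ ω, ENNReal.ofReal (X j ω) ∂μ ≤ ENNReal.ofReal ε) :
    ∫⁻ ω, dampingCost (fun j => X j ω) ∂μ ≤ ENNReal.ofReal (Real.exp (64 * (n * ε))) := by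
  have hmF := measurable_dampingFactor
  have hm : ∀ l, Measurable fun ω => dampingTerm l (fun j => X j ω) := fun l => by
    unfold dampingTerm; fun_prop
  have h32 : 0 ≤ 32 * (n * ε) := by positivity
  simp only [dampingCost]
  rw [lintegral_add_left measurable_const, lintegral_tsum fun l => (hm l).aemeasurable]
  calc _ ≤ 1 + ∑' l : ℕ, ENNReal.ofReal (32 * (n * ε)) * ENNReal.ofReal ((1 / 2) ^ l) := by
        gcongr with l
        · simp
        · exact lintegral_dampingTerm_le hX hX0 hind hε hnε hXε l
    _ = ENNReal.ofReal (1 + 32 * (n * ε) * 2) := by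
        rw [ENNReal.tsum_mul_left, ← ENNReal.ofReal_tsum_of_nonneg (fun l => by positivity)
          summable_geometric_two, tsum_geometric_two, ← ENNReal.ofReal_mul h32,
          ENNReal.ofReal_add zero_le_one (by positivity), ENNReal.ofReal_one]
    _ ≤ _ := ENNReal.ofReal_le_ofReal (by linarith [Real.add_one_le_exp (64 * (n * ε))])

end DampingExpectation

/-! ### Self-normalised sums -/

lemma exp_sub_sq_le (x : ℝ) : Real.exp (x - x ^ 2) ≤ 1 + x + x ^ 2 := by
  have hy : 0 < 1 + x + x ^ 2 := by nlinarith [sq_nonneg (x + 1 / 2)]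
  rw [← Real.le_log_iff_exp_le hy]
  refine le_trans ?_ (Real.one_sub_inv_le_log_of_pos hy)
  have h : (1 + x + x ^ 2) * (1 + x + x ^ 2)⁻¹ = 1 := mul_inv_cancel₀ hy.ne'
  have hi : 0 < (1 + x + x ^ 2)⁻¹ := inv_pos.2 hy
  -- after multiplication by `1 + x + x ^ 2` the claim reads `x - x ^ 4 ≤ x + x ^ 2`
  have h2 : (x - x ^ 2) * (1 + x + x ^ 2) ≤ x + x ^ 2 := by
    nlinarith [sq_nonneg (x ^ 2), sq_nonneg x]
  rw [← le_div_iff₀ hy] at h2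
  refine h2.trans (le_of_eq ?_)
  field_simp
  ring

section SelfNormalised

variable {Ω : Type*} [MeasurableSpace Ω] {μ : Measure Ω} [IsProbabilityMeasure μ] {n : ℕ}

lemma lintegral_exp_sub_sq_le {Y : Ω → ℝ} (hint : Integrable Y μ)
    (hint2 : Integrable (fun ω => Y ω ^ 2) μ) (h0 : ∫ ω, Y ω ∂μ = 0)
    (h1 : ∫ ω, Y ω ^ 2 ∂μ = 1) (u : ℝ) :
    ∫⁻ ω, ENNReal.ofReal (Real.exp (u * Y ω - (u * Y ω) ^ 2)) ∂μ
      ≤ ENNReal.ofReal (Real.exp (u ^ 2)) := by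
  have hI : Integrable (fun ω => 1 + u * Y ω + u ^ 2 * Y ω ^ 2) μ :=
    ((integrable_const _).add (hint.const_mul u)).add (hint2.const_mul _)
  calc _ ≤ ∫⁻ ω, ENNReal.ofReal (1 + u * Y ω + u ^ 2 * Y ω ^ 2) ∂μ := by
        refine lintegral_mono fun ω => ENNReal.ofReal_le_ofReal ?_
        rw [← mul_pow]
        exact exp_sub_sq_le _
    _ = ENNReal.ofReal (∫ ω, (1 + u * Y ω + u ^ 2 * Y ω ^ 2) ∂μ) := by
        refine (ofReal_integral_eq_lintegral_ofReal hI
          (Filter.Eventually.of_forall fun ω => ?_)).symm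
        have := (Real.exp_pos _).le.trans (exp_sub_sq_le (u * Y ω))
        rwa [mul_pow] at this
    _ = ENNReal.ofReal (1 + u ^ 2) := by
        have hI1 : Integrable (fun ω => 1 + u * Y ω) μ :=
          (integrable_const _).add (hint.const_mul u)
        rw [integral_add hI1 (hint2.const_mul _), integral_add (integrable_const _)
          (hint.const_mul u), integral_const_mul, integral_const_mul, h0, h1]
        simp
    _ ≤ _ := ENNReal.ofReal_le_ofReal (by linarith [Real.add_one_le_exp (u ^ 2)])

lemma lintegral_exp_selfNormalised_le {X : Fin n → Ω → ℝ} (hX : ∀ j, Measurable (X j))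
    (hind : iIndepFun X μ) (hint : ∀ j, Integrable (X j) μ)
    (hint2 : ∀ j, Integrable (fun ω => X j ω ^ 2) μ) (h0 : ∀ j, ∫ ω, X j ω ∂μ = 0)
    (h1 : ∀ j, ∫ ω, X j ω ^ 2 ∂μ = 1) {y : Fin n → ℝ} (hy : ∀ j, y j ^ 2 ≤ 1) (r : ℝ) :
    ∫⁻ ω, ENNReal.ofReal
        (Real.exp (r * ∑ j, y j * X j ω - r ^ 2 * ∑ j, (y j * X j ω) ^ 2)) ∂μ
      ≤ ENNReal.ofReal (Real.exp (r ^ 2 * n)) := by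
  let g : Fin n → ℝ → ENNReal := fun j x =>
    ENNReal.ofReal (Real.exp (r * y j * x - (r * y j * x) ^ 2))
  have hg : ∀ j, Measurable (g j) := fun j => by simp only [g]; fun_prop
  calc _ = ∫⁻ ω, ∏ j, g j (X j ω) ∂μ := by
        refine lintegral_congr fun ω => ?_
        rw [← ENNReal.ofReal_prod_of_nonneg fun j _ => (Real.exp_pos _).le, ← Real.exp_sum,
          Finset.sum_sub_distrib, Finset.mul_sum, Finset.mul_sum]
        simp only [mul_pow, mul_assoc]
    _ = ∏ j, ∫⁻ ω, g j (X j ω) ∂μ :=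
        lintegral_prod_eq_prod_lintegral_of_indepFun Finset.univ (fun j ω => g j (X j ω))
          (hind.comp g hg) fun j => (hg j).comp (hX j)
    _ ≤ ∏ _j : Fin n, ENNReal.ofReal (Real.exp (r ^ 2)) := by
        refine Finset.prod_le_prod' fun j _ => ?_
        refine (lintegral_exp_sub_sq_le (hint j) (hint2 j) (h0 j) (h1 j) (r * y j)).trans
          (ENNReal.ofReal_le_ofReal (Real.exp_le_exp.2 ?_))
        rw [mul_pow]
        exact mul_le_of_le_one_right (sq_nonneg r) (hy j)
    _ = _ := by
        rw [Finset.prod_const, Finset.card_univ, Fintype.card_fin,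
          ← ENNReal.ofReal_pow (Real.exp_pos _).le, ← Real.exp_nat_mul, mul_comm]

lemma lintegral_exp_neg_mul_sq {a : ℝ} (ha : 0 < a) :
    ∫⁻ r : ℝ, ENNReal.ofReal (Real.exp (-a * r ^ 2)) = ENNReal.ofReal √(Real.pi / a) := by
  rw [← integral_gaussian, ofReal_integral_eq_lintegral_ofReal (integrable_exp_neg_mul_sq ha)
    (Filter.Eventually.of_forall fun _ => (Real.exp_pos _).le)]

lemma lintegral_exp_mul_sub_mul_sq {c : ℝ} (hc : 0 < c) (s : ℝ) :
    ∫⁻ r : ℝ, ENNReal.ofReal (Real.exp (r * s - 2 * c * r ^ 2)) =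
      ENNReal.ofReal (Real.exp (s ^ 2 / (8 * c))) * ENNReal.ofReal √(Real.pi / (2 * c)) := by
  rw [← lintegral_exp_neg_mul_sq (by positivity : 0 < 2 * c),
    ← lintegral_sub_right_eq_self (fun r : ℝ => ENNReal.ofReal (Real.exp (-(2 * c) * r ^ 2)))
      (s / (4 * c)), ← lintegral_const_mul _ (by fun_prop)]
  refine lintegral_congr fun r => ?_
  rw [← ENNReal.ofReal_mul (Real.exp_pos _).le, ← Real.exp_add]
  congr 2
  field_simp
  ring

/-- A sum of independent standardised variables, on the event that its quadratic variation is at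
most `b`, is subgaussian with variance proxy of order `b + n`. The exponential of the square is
written as a Gaussian mixture of the exponential supermartingales of the sum. -/
lemma lintegral_indicator_exp_sq_le {X : Fin n → Ω → ℝ} (hX : ∀ j, Measurable (X j))
    (hind : iIndepFun X μ) (hint : ∀ j, Integrable (X j) μ)
    (hint2 : ∀ j, Integrable (fun ω => X j ω ^ 2) μ) (h0 : ∀ j, ∫ ω, X j ω ∂μ = 0)
    (h1 : ∀ j, ∫ ω, X j ω ^ 2 ∂μ = 1) {y : Fin n → ℝ} (hy : ∀ j, y j ^ 2 ≤ 1)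
    {b : ℝ} (hb : 0 < b) :
    ∫⁻ ω, {ω | ∑ j, (y j * X j ω) ^ 2 ≤ b}.indicator (fun ω =>
        ENNReal.ofReal (Real.exp ((∑ j, y j * X j ω) ^ 2 / (8 * (b + n))))) ω ∂μ
      ≤ ENNReal.ofReal √2 := by
  set c := b + n with hc
  have hc0 : 0 < c := by positivity
  have hπ : 0 < √(Real.pi / (2 * c)) := Real.sqrt_pos.2 (by positivity)
  have hcm : ENNReal.ofReal √(Real.pi / (2 * c)) ≠ 0 := (ENNReal.ofReal_pos.2 hπ).ne'
  rw [← ENNReal.mul_le_mul_iff_left hcm ENNReal.ofReal_ne_top,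
    ← lintegral_mul_const' _ _ ENNReal.ofReal_ne_top]
  calc _ ≤ ∫⁻ ω, (∫⁻ r : ℝ, ENNReal.ofReal
          (Real.exp (r * ∑ j, y j * X j ω - r ^ 2 * ∑ j, (y j * X j ω) ^ 2)) *
          ENNReal.ofReal (Real.exp (r ^ 2 * b - 2 * c * r ^ 2))) ∂μ := by
        refine lintegral_mono fun ω => ?_
        by_cases hω : ω ∈ {ω | ∑ j, (y j * X j ω) ^ 2 ≤ b}
        · rw [Set.indicator_of_mem hω, ← lintegral_exp_mul_sub_mul_sq hc0]
          refine lintegral_mono fun r => ?_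
          rw [← ENNReal.ofReal_mul (Real.exp_pos _).le, ← Real.exp_add]
          refine ENNReal.ofReal_le_ofReal (Real.exp_le_exp.2 ?_)
          have := mul_le_mul_of_nonneg_left (show ∑ j, (y j * X j ω) ^ 2 ≤ b from hω) (sq_nonneg r)
          linarith
        · rw [Set.indicator_of_notMem hω, zero_mul]
          exact zero_le
    _ = ∫⁻ r : ℝ, (∫⁻ ω, ENNReal.ofReal
          (Real.exp (r * ∑ j, y j * X j ω - r ^ 2 * ∑ j, (y j * X j ω) ^ 2)) *
          ENNReal.ofReal (Real.exp (r ^ 2 * b - 2 * c * r ^ 2)) ∂μ) := by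
        refine lintegral_lintegral_swap (Measurable.aemeasurable ?_)
        unfold Function.uncurry
        fun_prop
    _ ≤ ∫⁻ r : ℝ, ENNReal.ofReal (Real.exp (-c * r ^ 2)) := by
        refine lintegral_mono fun r => ?_
        rw [lintegral_mul_const' _ _ ENNReal.ofReal_ne_top]
        refine (mul_le_mul_left (lintegral_exp_selfNormalised_le hX hind hint hint2 h0 h1 hy r)
          _).trans (le_of_eq ?_)
        rw [← ENNReal.ofReal_mul (Real.exp_pos _).le, ← Real.exp_add]
        congr 2
        rw [hc]; ring
    _ = ENNReal.ofReal √2 * ENNReal.ofReal √(Real.pi / (2 * c)) := by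
        rw [lintegral_exp_neg_mul_sq hc0, ← ENNReal.ofReal_mul (Real.sqrt_nonneg _),
          ← Real.sqrt_mul (by norm_num)]
        congr 2
        field_simp

end SelfNormalised

/-! ### Independence of rows and moments of the entries -/

lemma iIndepFun_rows {Ω ι κ : Type*} [MeasurableSpace Ω] {μ : Measure Ω} [Countable κ]
    {X : ι → κ → Ω → ℝ} (hX : ∀ i j, Measurable (X i j))
    (h : iIndepFun (fun (p : ι × κ) => X p.1 p.2) μ) :
    iIndepFun (fun i ω j => X i j ω) μ := by
  have := h.isProbabilityMeasure
  have hp : ∀ i j, IsProbabilityMeasure (μ.map (X i j)) := fun i j =>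
    Measure.isProbabilityMeasure_map (hX i j).aemeasurable
  have hrow : ∀ i, μ.map (fun ω j => X i j ω) = Measure.infinitePi fun j => μ.map (X i j) :=
    fun i => (h.precomp (Prod.mk_right_injective i)).map_fun_eq_infinitePi_map (hX i)
  rw [iIndepFun_iff_map_fun_eq_infinitePi_map fun i => measurable_pi_lambda _ (hX i)]
  simp_rw [hrow]
  rw [← Measure.infinitePi_map_curry,
    ← h.map_fun_eq_infinitePi_map (X := fun p : ι × κ => X p.1 p.2) (fun p => hX p.1 p.2),
    Measure.map_map (by fun_prop)
      (show Measurable fun ω (p : ι × κ) => X p.1 p.2 ω from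
        measurable_pi_lambda _ fun p => hX p.1 p.2)]
  rfl

namespace HasIIDStandardEntries

variable {Ω : Type*} [MeasurableSpace Ω] {μ : Measure Ω} {n : ℕ}
  {A : Ω → Matrix (Fin n) (Fin n) ℝ}

lemma integrable_sq (hA : HasIIDStandardEntries A μ) (i j : Fin n) :
    Integrable (fun ω => A ω i j ^ 2) μ := by
  -- a non-integrable function would have integral zero, not one
  by_contra h
  have := hA.second_moment_one i j
  rw [integral_undef h] at this
  norm_num at this

lemma integrable [IsProbabilityMeasure μ] (hA : HasIIDStandardEntries A μ) (i j : Fin n) :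
    Integrable (fun ω => A ω i j) μ :=
  ((memLp_two_iff_integrable_sq (hA.measurable_entry i j).aestronglyMeasurable).2
    (hA.integrable_sq i j)).integrable (by norm_num)

lemma iIndepFun_row (hA : HasIIDStandardEntries A μ) (i : Fin n) :
    iIndepFun (fun j ω => A ω i j) μ :=
  hA.indep.precomp (Prod.mk_right_injective i)

lemma lintegral_prod_rows (hA : HasIIDStandardEntries A μ) {f : (Fin n → ℝ) → ENNReal}
    (hf : Measurable f) :
    ∫⁻ ω, ∏ i, f (fun j => A ω i j) ∂μ = ∏ i, ∫⁻ ω, f (fun j => A ω i j) ∂μ :=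
  lintegral_prod_eq_prod_lintegral_of_indepFun Finset.univ (fun i ω => f (fun j => A ω i j))
    ((iIndepFun_rows hA.measurable_entry hA.indep).comp (fun _ => f) fun _ => hf)
    fun i => hf.comp (measurable_pi_lambda _ (hA.measurable_entry i))

/-! ### The two exceptional events -/

lemma measure_exp_le_prod_dampingCost_le [IsProbabilityMeasure μ]
    (hA : HasIIDStandardEntries A μ) {δ : ℝ} (hδ : 0 < δ) (hδ1 : δ ≤ 1) (hn : 0 < n) :
    μ {ω | ENNReal.ofReal (Real.exp (δ * n)) ≤
        ∏ i, dampingCost fun j => δ / (128 * n) * A ω i j ^ 2}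
      ≤ ENNReal.ofReal (Real.exp (-(δ * n / 2))) := by
  have hn' : (0 : ℝ) < n := Nat.cast_pos.2 hn
  set ε := δ / (128 * n) with hε
  have hε0 : 0 ≤ ε := by positivity
  have hnε : n * ε = δ / 128 := by rw [hε]; field_simp
  have hf : Measurable fun x : Fin n → ℝ => dampingCost fun j => ε * x j ^ 2 :=
    measurable_dampingCost.comp (by fun_prop)
  have hrow : ∀ i, ∫⁻ ω, dampingCost (fun j => ε * A ω i j ^ 2) ∂μ
      ≤ ENNReal.ofReal (Real.exp (δ / 2)) := fun i => by
    have hm := hA.measurable_entry i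
    refine (lintegral_dampingCost_le (μ := μ) (X := fun j ω => ε * A ω i j ^ 2) (ε := ε)
      (fun j => by fun_prop) (fun j ω => by positivity)
      ((hA.iIndepFun_row i).comp (fun _ x => ε * x ^ 2) fun _ => by fun_prop) hε0
      (by rw [hnε]; linarith) fun j => ?_).trans
      (ENNReal.ofReal_le_ofReal (Real.exp_le_exp.2 (by rw [hnε]; linarith)))
    rw [← ofReal_integral_eq_lintegral_ofReal ((hA.integrable_sq i j).const_mul ε)
      (Filter.Eventually.of_forall fun ω => by positivity), integral_const_mul,
      hA.second_moment_one, mul_one]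
  have hpos : 0 < Real.exp (δ * n) := Real.exp_pos _
  have hmeas : Measurable fun ω => ∏ i, dampingCost fun j => ε * A ω i j ^ 2 :=
    Finset.measurable_prod _ fun i _ =>
      hf.comp (measurable_pi_lambda _ (hA.measurable_entry i))
  refine (meas_ge_le_lintegral_div hmeas.aemeasurable (ENNReal.ofReal_pos.2 hpos).ne'
    ENNReal.ofReal_ne_top).trans ?_
  rw [hA.lintegral_prod_rows hf]
  calc _ ≤ (∏ _i : Fin n, ENNReal.ofReal (Real.exp (δ / 2))) / ENNReal.ofReal (Real.exp (δ * n)) :=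
        ENNReal.div_le_div_right (Finset.prod_le_prod' fun i _ => hrow i) _
    _ = _ := by
        rw [Finset.prod_const, Finset.card_univ, Fintype.card_fin,
          ← ENNReal.ofReal_pow (Real.exp_pos _).le, ← ENNReal.ofReal_div_of_pos hpos,
          ← Real.exp_nat_mul, ← Real.exp_sub]
        congr 2
        ring

lemma measure_sum_sq_ge_le [IsProbabilityMeasure μ] (hA : HasIIDStandardEntries A μ)
    {y : Fin n → ℝ} (hy : ∀ j, y j ^ 2 ≤ 1) {b : ℝ} (hb : 0 < b) (T : ℝ) :
    μ {ω | (∀ i, ∑ j, (y j * A ω i j) ^ 2 ≤ b) ∧ T ≤ ∑ i, (∑ j, y j * A ω i j) ^ 2}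
      ≤ ENNReal.ofReal (√2 ^ n * Real.exp (-(T / (8 * (b + n))))) := by
  set c := b + n with hc
  have hc0 : 0 < c := by positivity
  let f : (Fin n → ℝ) → ENNReal := {x | ∑ j, (y j * x j) ^ 2 ≤ b}.indicator fun x =>
    ENNReal.ofReal (Real.exp ((∑ j, y j * x j) ^ 2 / (8 * c)))
  have hf : Measurable f := by
    refine Measurable.indicator (by fun_prop) (measurableSet_le (by fun_prop) (by fun_prop))
  have hpos : 0 < Real.exp (T / (8 * c)) := Real.exp_pos _
  have hmeas : Measurable fun ω => ∏ i, f fun j => A ω i j :=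
    Finset.measurable_prod _ fun i _ =>
      hf.comp (measurable_pi_lambda _ (hA.measurable_entry i))
  calc _ ≤ μ {ω | ENNReal.ofReal (Real.exp (T / (8 * c))) ≤ ∏ i, f fun j => A ω i j} := by
        refine measure_mono fun ω hω => ?_
        obtain ⟨h1, h2⟩ := hω
        have h3 : ∏ i, f (fun j => A ω i j) =
            ENNReal.ofReal (Real.exp ((∑ i, (∑ j, y j * A ω i j) ^ 2) / (8 * c))) := by
          rw [Finset.sum_div, Real.exp_sum,
            ENNReal.ofReal_prod_of_nonneg fun i _ => (Real.exp_pos _).le]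
          exact Finset.prod_congr rfl fun i _ => Set.indicator_of_mem
            (show (fun j => A ω i j) ∈ {x : Fin n → ℝ | ∑ j, (y j * x j) ^ 2 ≤ b} from h1 i) _
        change _ ≤ ∏ i, f fun j => A ω i j
        rw [h3]
        gcongr
    _ ≤ (∫⁻ ω, ∏ i, f (fun j => A ω i j) ∂μ) / ENNReal.ofReal (Real.exp (T / (8 * c))) :=
        meas_ge_le_lintegral_div hmeas.aemeasurable (ENNReal.ofReal_pos.2 hpos).ne'
          ENNReal.ofReal_ne_top
    _ ≤ (∏ _i : Fin n, ENNReal.ofReal √2) / ENNReal.ofReal (Real.exp (T / (8 * c))) := by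
        rw [hA.lintegral_prod_rows hf]
        refine ENNReal.div_le_div_right (Finset.prod_le_prod' fun i _ => ?_) _
        exact lintegral_indicator_exp_sq_le (hA.measurable_entry i) (hA.iIndepFun_row i)
          (hA.integrable i) (hA.integrable_sq i) (hA.mean_zero i) (hA.second_moment_one i) hy hb
    _ = _ := by
        rw [Finset.prod_const, Finset.card_univ, Fintype.card_fin,
          ← ENNReal.ofReal_pow (Real.sqrt_nonneg _), ← ENNReal.ofReal_div_of_pos hpos,
          Real.exp_neg, div_eq_mul_inv]

end HasIIDStandardEntries

/-! ### The norm from `ℓ∞` to `ℓ2` -/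

/-- The vertices of the cube `[-1, 1]ⁿ`. -/
noncomputable def signVectors (n : ℕ) : Finset (Fin n → ℝ) :=
  Fintype.piFinset fun _ => {-1, 1}

lemma card_signVectors (n : ℕ) : (signVectors n).card = 2 ^ n := by
  have h : ({-1, 1} : Finset ℝ).card = 2 := Finset.card_pair (by norm_num)
  simp [signVectors, h]

lemma sq_eq_one_of_mem_signVectors {n : ℕ} {s : Fin n → ℝ} (hs : s ∈ signVectors n) (j : Fin n) :
    s j ^ 2 = 1 := by
  have := Fintype.mem_piFinset.1 hs j
  simp only [Finset.mem_insert, Finset.mem_singleton] at this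
  rcases this with h | h <;> rw [h] <;> norm_num

/-- The unit ball of `ℓ∞` is the convex hull of the sign vectors, so a convex function on it is
largest at one of them. -/
lemma normInftyTwo_le_of_signVectors {m n : ℕ} {M : Matrix (Fin m) (Fin n) ℝ} {T : ℝ} (hT : 0 ≤ T)
    (h : ∀ s ∈ signVectors n, ∑ i, (∑ j, M i j * s j) ^ 2 ≤ T ^ 2) : normInftyTwo M ≤ T := by
  set L : (Fin n → ℝ) →L[ℝ] EuclideanSpace ℝ (Fin m) := LinearMap.toContinuousLinearMap
    ((WithLp.linearEquiv 2 ℝ (Fin m → ℝ)).symm.toLinearMap ∘ₗ M.mulVecLin) with hL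
  change ‖L‖ ≤ T
  refine ContinuousLinearMap.opNorm_le_of_unit_norm hT fun x hx => ?_
  have hconv : ConvexOn ℝ Set.univ fun x => ‖L x‖ :=
    convexOn_univ_norm.comp_linearMap L.toLinearMap
  have hmem : x ∈ convexHull ℝ (Set.univ.pi fun _ : Fin n => ({-1, 1} : Set ℝ)) := by
    rw [convexHull_pi]
    intro j _
    rw [convexHull_pair, segment_eq_Icc (by norm_num)]
    exact abs_le.1 ((norm_le_pi_norm x j).trans hx.le)
  obtain ⟨s, hs, hxs⟩ := hconv.exists_ge_of_mem_convexHull (Set.subset_univ _) hmem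
  refine hxs.trans ?_
  have hs' : s ∈ signVectors n := Fintype.mem_piFinset.2 fun j => by
    simpa using hs j (Set.mem_univ j)
  rw [EuclideanSpace.norm_eq]
  refine Real.sqrt_le_iff.2 ⟨hT, ?_⟩
  simp only [Real.norm_eq_abs, sq_abs]
  exact h s hs'

/-- If every row of `M` can be damped, the columnwise smallest weights damp all rows at once, and
their product is at least the product of all row weights. -/
lemma exists_common_weights {n : ℕ} (hn : 0 < n) {κ : Fin n → Fin n → ℕ} :
    ∃ k : Fin n → ℕ, (∀ i j, dyadicWeight (k j) ≤ dyadicWeight (κ i j)) ∧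
      ∏ i, ∏ j, dyadicWeight (κ i j) ≤ ∏ j, dyadicWeight (k j) := by
  have : Nonempty (Fin n) := ⟨⟨0, hn⟩⟩
  refine ⟨fun j => Finset.univ.sup fun i => κ i j, fun i j =>
    dyadicWeight_antitone (Finset.le_sup (f := fun i => κ i j) (Finset.mem_univ i)), ?_⟩
  rw [Finset.prod_comm]
  refine Finset.prod_le_prod (fun j _ => Finset.prod_nonneg fun i _ => (dyadicWeight_pos _).le)
    fun j _ => ?_
  obtain ⟨i, -, hi⟩ := Finset.exists_mem_eq_sup Finset.univ Finset.univ_nonempty fun i => κ i j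
  change _ ≤ dyadicWeight (Finset.univ.sup fun i => κ i j)
  rw [hi, ← Finset.mul_prod_erase _ _ (Finset.mem_univ i)]
  exact mul_le_of_le_one_right (dyadicWeight_pos _).le
    (Finset.prod_le_one (fun i _ => (dyadicWeight_pos _).le) fun i _ => dyadicWeight_le_one _)

/-! ### Union bound and conclusion -/

lemma two_mul_exp_one_mul_sqrt_two_le : 2 * (2 * Real.exp 1) * √2 ≤ Real.exp 3 := by
  have h1 : √2 ≤ 3 / 2 := by rw [Real.sqrt_le_left (by norm_num)]; norm_num
  have h2 : (2.7 : ℝ) ≤ Real.exp 1 := by linarith [Real.exp_one_gt_d9]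
  have h3 : Real.exp 3 = Real.exp 1 * Real.exp 1 * Real.exp 1 := by
    rw [← Real.exp_add, ← Real.exp_add]; norm_num
  have h4 : 2 * 2 * √2 ≤ Real.exp 1 * Real.exp 1 := by nlinarith
  rw [h3]
  nlinarith [Real.exp_pos 1]

/-- The union bound over all sign vectors and over the at most `(2e)ⁿ` admissible weights of large
product. -/
lemma HasIIDStandardEntries.measure_exists_sum_sq_ge_le {Ω : Type*} [MeasurableSpace Ω]
    {μ : Measure Ω} [IsProbabilityMeasure μ] {n : ℕ} {A : Ω → Matrix (Fin n) (Fin n) ℝ}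
    (hA : HasIIDStandardEntries A μ) {δ : ℝ} (hδ : 0 < δ) (hδ1 : δ ≤ 1) (hn : 0 < n) :
    μ {ω | ∃ κ : Fin n → ℕ, Real.exp (-n) ≤ ∏ j, dyadicWeight (κ j) ∧ ∃ s ∈ signVectors n,
        (∀ i, ∑ j, (dyadicWeight (κ j) * s j * A ω i j) ^ 2 ≤ 256 * n / δ) ∧
        10000 * n ^ 2 / δ ≤ ∑ i, (∑ j, dyadicWeight (κ j) * s j * A ω i j) ^ 2}
      ≤ ENNReal.ofReal (Real.exp (-n)) := by
  have hn' : (0 : ℝ) < n := Nat.cast_pos.2 hn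
  obtain ⟨𝒦, h𝒦, hcard⟩ := card_dyadicWeight_prod_ge n
  set b : ℝ := 256 * n / δ with hb
  set T : ℝ := 10000 * n ^ 2 / δ with hT
  have hb0 : 0 < b := by positivity
  let E : (Fin n → ℕ) → (Fin n → ℝ) → Set Ω := fun κ s =>
    {ω | (∀ i, ∑ j, (dyadicWeight (κ j) * s j * A ω i j) ^ 2 ≤ b) ∧
      T ≤ ∑ i, (∑ j, dyadicWeight (κ j) * s j * A ω i j) ^ 2}
  have hE : ∀ κ, ∀ s ∈ signVectors n, μ (E κ s) ≤
      ENNReal.ofReal (√2 ^ n * Real.exp (-(T / (8 * (b + n))))) := fun κ s hs => by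
    refine hA.measure_sum_sq_ge_le (fun j => ?_) hb0 T
    rw [mul_pow, sq_eq_one_of_mem_signVectors hs, mul_one]
    exact pow_le_one₀ (dyadicWeight_pos _).le (dyadicWeight_le_one _)
  have hexp : 4 * (n : ℝ) ≤ T / (8 * (b + n)) := by
    have h1 : (n : ℝ) ≤ n / δ := by rw [le_div_iff₀ hδ]; nlinarith
    have h2 : b + n ≤ 257 * (n / δ) := by rw [hb, mul_div_assoc]; linarith
    rw [le_div_iff₀ (by positivity)]
    calc 4 * (n : ℝ) * (8 * (b + n)) ≤ 4 * n * (8 * (257 * (n / δ))) := by gcongr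
      _ = 8224 * (n ^ 2 / δ) := by ring
      _ ≤ 10000 * (n ^ 2 / δ) := by gcongr; norm_num
      _ = T := by rw [hT, mul_div_assoc]
  calc _ ≤ μ (⋃ κ ∈ 𝒦, ⋃ s ∈ signVectors n, E κ s) := by
        refine measure_mono fun ω hω => ?_
        obtain ⟨κ, hκ, s, hs, h⟩ := hω
        simp only [Set.mem_iUnion]
        exact ⟨κ, h𝒦 κ hκ, s, hs, h⟩
    _ ≤ ∑ κ ∈ 𝒦, ∑ s ∈ signVectors n, μ (E κ s) :=
        (measure_biUnion_finset_le _ _).trans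
          (Finset.sum_le_sum fun κ _ => measure_biUnion_finset_le _ _)
    _ ≤ ∑ _κ ∈ 𝒦, ∑ _s ∈ signVectors n,
          ENNReal.ofReal (√2 ^ n * Real.exp (-(T / (8 * (b + n))))) :=
        Finset.sum_le_sum fun κ _ => Finset.sum_le_sum fun s hs => hE κ s hs
    _ = ENNReal.ofReal (𝒦.card * (2 ^ n * (√2 ^ n * Real.exp (-(T / (8 * (b + n))))))) := by
        rw [ENNReal.ofReal_mul (Nat.cast_nonneg _),
          ENNReal.ofReal_mul (by positivity : (0 : ℝ) ≤ 2 ^ n)]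
        simp [card_signVectors]
    _ ≤ ENNReal.ofReal (Real.exp (-n)) := by
        refine ENNReal.ofReal_le_ofReal ?_
        have hpow : 2 ^ n * (2 ^ n * Real.exp n) * √2 ^ n ≤ Real.exp (3 * n) := by
          have := pow_le_pow_left₀ (by positivity) two_mul_exp_one_mul_sqrt_two_le n
          rw [mul_pow, mul_pow, mul_pow, ← Real.exp_nat_mul, ← Real.exp_nat_mul, mul_one,
            mul_comm (n : ℝ) 3] at this
          exact this
        calc _ ≤ 2 ^ n * Real.exp n * (2 ^ n * (√2 ^ n * Real.exp (-(4 * n)))) := by gcongr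
          _ = 2 ^ n * (2 ^ n * Real.exp n) * √2 ^ n * Real.exp (-(4 * n)) := by ring
          _ ≤ Real.exp (3 * n) * Real.exp (-(4 * n)) := by gcongr
          _ = Real.exp (-n) := by rw [← Real.exp_add]; congr 1; ring

/-- Outside the two exceptional events the required diagonal matrix exists. -/
lemma exists_dyadicDiagContraction {n : ℕ} (hn : 0 < n) {δ : ℝ} (hδ : 0 < δ) (hδ1 : δ ≤ 1)
    {M : Matrix (Fin n) (Fin n) ℝ}
    (hcost : ∏ i, dampingCost (fun j => δ / (128 * n) * M i j ^ 2)
      < ENNReal.ofReal (Real.exp (δ * n)))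
    (hvert : ∀ κ : Fin n → ℕ, Real.exp (-n) ≤ ∏ j, dyadicWeight (κ j) → ∀ s ∈ signVectors n,
      (∀ i, ∑ j, (dyadicWeight (κ j) * s j * M i j) ^ 2 ≤ 256 * n / δ) →
      ∑ i, (∑ j, dyadicWeight (κ j) * s j * M i j) ^ 2 < 10000 * n ^ 2 / δ) :
    ∃ D ∈ dyadicDiagContractions n,
      Real.exp (-δ * n) ≤ D.det ∧ normInftyTwo (M * D) ≤ 100 / √δ * n := by
  have hn' : (0 : ℝ) < n := Nat.cast_pos.2 hn
  choose κ hκ₁ hκ₂ using fun i =>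
    exists_damping (x := fun j => δ / (128 * n) * M i j ^ 2) fun j => by positivity
  obtain ⟨k, hk, hkprod⟩ := exists_common_weights hn (κ := κ)
  have hP : 0 < ∏ i, ∏ j, dyadicWeight (κ i j) :=
    Finset.prod_pos fun i _ => Finset.prod_pos fun j _ => dyadicWeight_pos _
  have hdet : Real.exp (-δ * n) ≤ ∏ j, dyadicWeight (k j) := by
    have h1 : ENNReal.ofReal (∏ i, ∏ j, (dyadicWeight (κ i j))⁻¹)
        < ENNReal.ofReal (Real.exp (δ * n)) := by
      refine lt_of_le_of_lt ?_ hcost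
      rw [ENNReal.ofReal_prod_of_nonneg fun i _ => Finset.prod_nonneg fun j _ =>
        (inv_pos.2 (dyadicWeight_pos _)).le]
      exact Finset.prod_le_prod' fun i _ => hκ₂ i
    have h2 := ((ENNReal.ofReal_lt_ofReal_iff (Real.exp_pos _)).1 h1).le
    simp only [Finset.prod_inv_distrib] at h2
    rw [neg_mul, Real.exp_neg]
    exact (inv_le_of_inv_le₀ hP h2).trans hkprod
  have hrow : ∀ i, ∑ j, dyadicWeight (k j) ^ 2 * M i j ^ 2 ≤ 256 * n / δ := fun i => by
    have h1 : δ / (128 * n) * ∑ j, dyadicWeight (k j) ^ 2 * M i j ^ 2 ≤ 2 := by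
      rw [Finset.mul_sum]
      refine le_trans (Finset.sum_le_sum fun j _ => ?_) (hκ₁ i)
      have h2 : dyadicWeight (k j) ^ 2 ≤ dyadicWeight (κ i j) ^ 2 :=
        pow_le_pow_left₀ (dyadicWeight_pos _).le (hk i j) 2
      calc _ = dyadicWeight (k j) ^ 2 * (δ / (128 * n) * M i j ^ 2) := by ring
        _ ≤ _ := mul_le_mul_of_nonneg_right h2 (by positivity)
    rw [le_div_iff₀ hδ]
    rw [div_mul_eq_mul_div, div_le_iff₀ (by positivity)] at h1
    linarith
  refine ⟨Matrix.diagonal fun j => dyadicWeight (k j),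
    ⟨⟨Matrix.isDiag_diagonal _, fun i => ?_⟩, fun i => ?_⟩, ?_, ?_⟩
  · rw [Matrix.diagonal_apply_eq]
    exact ⟨dyadicWeight_pos _, dyadicWeight_le_one _⟩
  · rw [Matrix.diagonal_apply_eq]
    exact dyadicWeight_mem _
  · rwa [Matrix.det_diagonal]
  · refine normInftyTwo_le_of_signVectors (by positivity) fun s hs => ?_
    have hT : (100 / √δ * n) ^ 2 = 10000 * n ^ 2 / δ := by
      rw [mul_pow, div_pow, Real.sq_sqrt hδ.le]; ring
    rw [hT]
    have hcomm : ∀ i j, (M * Matrix.diagonal fun j => dyadicWeight (k j)) i j * s j =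
        dyadicWeight (k j) * s j * M i j := fun i j => by
      rw [Matrix.mul_diagonal]; ring
    simp only [hcomm]
    refine (hvert k (le_trans (Real.exp_le_exp.2 ?_) hdet) s hs fun i => ?_).le
    · nlinarith
    · refine le_trans (le_of_eq (Finset.sum_congr rfl fun j _ => ?_)) (hrow i)
      rw [mul_pow, mul_pow, sq_eq_one_of_mem_signVectors hs, mul_one]

theorem mainTheorem3 :
    ∃ C : ℝ, 0 < C ∧
      ∀ (n : ℕ) (δ : ℝ), 0 < δ → δ ≤ 1 →
      ∀ (Ω : Type*) [MeasurableSpace Ω] (μ : Measure Ω) [IsProbabilityMeasure μ]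
        (A : Ω → Matrix (Fin n) (Fin n) ℝ), HasIIDStandardEntries A μ →
        μ.real {ω | ∃ D ∈ dyadicDiagContractions n,
            Real.exp (-δ * n) ≤ D.det ∧ normInftyTwo (A ω * D) ≤ C / Real.sqrt δ * n}
          ≥ 1 - 4 * Real.exp (-δ * n / 8) := by
  refine ⟨100, by norm_num, fun n δ hδ hδ1 Ω _ μ _ A hA => ?_⟩
  set S := {ω | ∃ D ∈ dyadicDiagContractions n,
    Real.exp (-δ * n) ≤ D.det ∧ normInftyTwo (A ω * D) ≤ 100 / √δ * n}
  rcases Nat.eq_zero_or_pos n with hn | hn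
  · -- the lower bound is negative for `n = 0`
    have h : Real.exp (-δ * n / 8) = 1 := by simp [hn]
    rw [h]
    linarith [measureReal_nonneg (μ := μ) (s := S)]
  set E₁ := {ω | ENNReal.ofReal (Real.exp (δ * n)) ≤
    ∏ i, dampingCost fun j => δ / (128 * n) * A ω i j ^ 2}
  set E₂ := {ω | ∃ κ : Fin n → ℕ, Real.exp (-n) ≤ ∏ j, dyadicWeight (κ j) ∧
    ∃ s ∈ signVectors n,
      (∀ i, ∑ j, (dyadicWeight (κ j) * s j * A ω i j) ^ 2 ≤ 256 * n / δ) ∧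
      10000 * n ^ 2 / δ ≤ ∑ i, (∑ j, dyadicWeight (κ j) * s j * A ω i j) ^ 2}
  have hcover : Set.univ ⊆ S ∪ (E₁ ∪ E₂) := fun ω _ => by
    by_contra hω
    simp only [Set.mem_union, not_or] at hω
    refine hω.1 (exists_dyadicDiagContraction hn hδ hδ1 (not_le.1 hω.2.1) ?_)
    intro κ hκ s hs hrow
    by_contra! h
    exact hω.2.2 ⟨κ, hκ, s, hs, hrow, h⟩
  have h1 : μ.real E₁ ≤ Real.exp (-(δ * n / 2)) :=
    ENNReal.toReal_le_of_le_ofReal (Real.exp_pos _).le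
      (hA.measure_exp_le_prod_dampingCost_le hδ hδ1 hn)
  have h2 : μ.real E₂ ≤ Real.exp (-n) :=
    ENNReal.toReal_le_of_le_ofReal (Real.exp_pos _).le
      (hA.measure_exists_sum_sq_ge_le hδ hδ1 hn)
  have h3 : 1 ≤ μ.real S + (μ.real E₁ + μ.real E₂) := by
    calc 1 = μ.real Set.univ := probReal_univ.symm
      _ ≤ μ.real (S ∪ (E₁ ∪ E₂)) := measureReal_mono hcover
      _ ≤ μ.real S + μ.real (E₁ ∪ E₂) := measureReal_union_le _ _
      _ ≤ _ := by gcongr; exact measureReal_union_le _ _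
  have hn' : (0 : ℝ) < n := Nat.cast_pos.2 hn
  have hδn : δ * n ≤ n := by nlinarith
  have hδn0 : 0 < δ * n := by positivity
  have h4 : Real.exp (-(δ * n / 2)) ≤ Real.exp (-δ * n / 8) :=
    Real.exp_le_exp.2 (by linarith)
  have h5 : Real.exp (-n) ≤ Real.exp (-δ * n / 8) := Real.exp_le_exp.2 (by linarith)
  linarith [Real.exp_pos (-δ * n / 8)]
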